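/- Let $q$ be a prime power with $q \equiv \pm 3 \pmod 8$, and let $n$ be a positive integer that is neither of the form $2^w$ nor of the form $2^w(2^{2k}+1)$ with integers $w, k \ge 0$. Let $G = PSp_{2n}(q) = Sp_{2n}(q)/Z(Sp_{2n}(q))$ be the projective symplectic group over the field with $q$ elements. Then $G$ has a subgroup $H$ of odd index that is not pronormal in $G$. Here a subgroup $H$ of a finite group $G$ is called pronormal in $G$ if, for every $g \in G$, the subgroups $H$ and $H^g = g^{-1}Hg$ are conjugate in $\langle H, H^g\rangle$, that is, $H^x = H^g$ for some $x \in \langle H, H^g\rangle$. -/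

import Mathlib

/-- The projective symplectic group `PSp_{2n}(K)`: the quotient of the symplectic group of
`2n × 2n` matrices over `K` by its center. -/
abbrev ProjectiveSymplecticGroup (n : ℕ) (K : Type*) [Field K] : Type _ :=
  Matrix.symplecticGroup (Fin n) K ⧸ Subgroup.center (Matrix.symplecticGroup (Fin n) K)

/-- The conjugate `H ^ g = g⁻¹ H g` of a subgroup. -/
def conjSubgroup {G : Type*} [Group G] (H : Subgroup G) (g : G) : Subgroup G :=
  H.map (MulAut.conj g⁻¹).toMonoidHom

/-- `H` is pronormal in `G` if, for every `g` in `G`, the subgroups `H` and `H ^ g` are conjugate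
in the subgroup `⟨H, H ^ g⟩` that they generate. -/
def IsPronormal {G : Type*} [Group G] (H : Subgroup G) : Prop :=
  ∀ g : G, ∃ x ∈ H ⊔ conjSubgroup H g, conjSubgroup H x = conjSubgroup H g

/-!
Decompose the symplectic space of dimension `2 * n` into `n` orthogonal hyperbolic planes. The
stabilizer of this decomposition is `SL(2, K) ≀ Perm (Fin n)`, embedded in the symplectic group as
the block-monomial matrices (`monomialHom`). Its index is odd (`odd_index_range_monomialHom`): the
quarter turns in the single planes generate a `2`-group which fixes no other decomposition, so it
has exactly one fixed point on the cosets of the stabilizer. This avoids the order formula of the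
symplectic group.

As `|K| ≡ ±3` modulo `8`, the largest power of `2` dividing `|SL(2, K)|` is `8`, so a quaternion
subgroup `Q` has odd index. It is normalized by an element of order `3`, the image of a Hurwitz
unit, and the group `N` generated by both has a nontrivial homomorphism `φ` with kernel `Q` to a
group of exponent `3` (`exists_hom_odd_index_map_ker`). By the assumption on `n` there is a positive multiple
`m` of `3` with `n.choose m` odd (`exists_odd_choose_three_dvd`). Let `T` be the stabilizer in
`Perm (Fin n)` of a set `s` of size `m`. The required subgroup is the image of `H = Q ≀ T`, whose
index in `SL(2, K) ≀ Perm (Fin n)` is the product of `n.choose m` and a power of the index of `Q`,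
hence odd.

Inside `N ≀ T`, the product over `s` of the values of `φ` at the coordinates is a homomorphism `χ`
which is trivial on `H`, hence on all its conjugates. It is also trivial on the normalizer of `H`:
the coordinates in `s` of an element of the normalizer have equal values under `φ`, and these are
multiplied `m` times, where `3 ∣ m`. But `χ` is not trivial, so that for `g` with `χ g ≠ 1` no
element of `⟨H, H ^ g⟩` can conjugate `H` to `H ^ g`
(`PermWreath.not_isPronormal_kerWreath`). As the preimage of the center lies in `H`, this passes to
the projective symplectic group (`IsPronormal.of_map`).
-/

/-! ### Transferring pronormality along homomorphisms, and odd indices -/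

lemma mem_conjSubgroup {G : Type*} [Group G] {H : Subgroup G} {g x : G} :
    x ∈ conjSubgroup H g ↔ g * x * g⁻¹ ∈ H := by
  constructor
  · rintro ⟨y, hy, rfl⟩
    simpa [mul_assoc] using hy
  · intro h
    exact ⟨_, h, by simp [mul_assoc]⟩

lemma map_conjSubgroup {G G' : Type*} [Group G] [Group G'] (f : G →* G') (H : Subgroup G) (g : G) :
    (conjSubgroup H g).map f = conjSubgroup (H.map f) (f g) := by
  rw [conjSubgroup, conjSubgroup, Subgroup.map_map, Subgroup.map_map]
  congr 1
  ext x
  simp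

/-- Pronormality of an image gives pronormality of a subgroup containing the kernel: conjugating
elements lift, since `f` maps the subgroup generated by `H` and `H ^ g` onto the subgroup generated
by their images. The homomorphism `f` need not be surjective. -/
lemma IsPronormal.of_map {G G' : Type*} [Group G] [Group G'] (f : G →* G') (H : Subgroup G)
    (hf : f.ker ≤ H) (h : IsPronormal (H.map f)) : IsPronormal H := by
  intro g
  obtain ⟨x, hx, hxg⟩ := h (f g)
  rw [← map_conjSubgroup, ← Subgroup.map_sup] at hx
  obtain ⟨y, hy, rfl⟩ := hx
  refine ⟨y, hy, ?_⟩
  rw [← map_conjSubgroup, ← map_conjSubgroup] at hxg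
  have key : ∀ z : G, f.ker ≤ conjSubgroup H z := by
    intro z k hk
    rw [mem_conjSubgroup]
    apply hf
    rw [MonoidHom.mem_ker] at hk ⊢
    simp [hk]
  have := congrArg (Subgroup.comap f) hxg
  rwa [Subgroup.comap_map_eq_self (key y), Subgroup.comap_map_eq_self (key g)] at this

/-- If a `2`-subgroup `C` of `M` lies in a conjugate of `M` by `g` only when `g ∈ M`, then `C` has
exactly one fixed point on the cosets of `M`, so the index of `M` is odd. -/
lemma odd_index_of_forall_conj_mem {G : Type*} [Group G] [Finite G] {M C : Subgroup G}
    (hC : IsPGroup 2 C) (hCM : C ≤ M)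
    (h : ∀ g : G, (∀ c ∈ C, g⁻¹ * c * g ∈ M) → g ∈ M) : Odd M.index := by
  have := Fact.mk Nat.prime_two
  have key := hC.card_modEq_card_fixedPoints (G ⧸ M)
  have hone : MulAction.fixedPoints C (G ⧸ M) = {((1 : G) : G ⧸ M)} := by
    ext x
    induction x using QuotientGroup.induction_on with
    | H g =>
    simp only [MulAction.mem_fixedPoints, Set.mem_singleton_iff]
    have hsmul : ∀ c : C, c • (g : G ⧸ M) = ((c * g : G) : G ⧸ M) := fun c => rfl
    constructor
    · intro hg
      have : g ∈ M := by
        apply h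
        intro c hc
        have h1 := hg ⟨c, hc⟩
        rw [hsmul, eq_comm, QuotientGroup.eq] at h1
        simpa [mul_assoc] using h1
      rw [QuotientGroup.eq]
      simpa using this
    · intro hg c
      rw [hsmul, hg, QuotientGroup.eq]
      rw [QuotientGroup.eq] at hg
      have hgM : g ∈ M := by simpa using hg
      simpa using M.mul_mem (M.inv_mem hgM) (M.inv_mem (hCM c.2))
  rw [hone, Nat.card_coe_set_eq, Set.ncard_singleton] at key
  exact Nat.odd_iff.mpr key

/-! ### A non-pronormal subgroup of a permutational wreath product -/

/-- The permutational wreath product `N ≀ T` of a group `N` by a group `T` acting on `ι`. -/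
abbrev PermWreath (N ι T : Type*) [Group N] [Group T] [MulAction T ι] : Type _ :=
  (ι → N) ⋊[(mulAutArrow : T →* MulAut (ι → N))] T

namespace PermWreath

variable {N N' A ι T T' : Type*} [Group N] [Group N'] [CommGroup A] [Group T] [MulAction T ι]
  [Group T'] [MulAction T' ι]

lemma mul_left_apply (x y : PermWreath N ι T) (i : ι) :
    (x * y).left i = x.left i * y.left (x.right⁻¹ • i) := rfl

lemma inv_left_apply (x : PermWreath N ι T) (i : ι) :
    x⁻¹.left i = (x.left (x.right • i))⁻¹ := by
  change (x.left (x.right⁻¹⁻¹ • i))⁻¹ = _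
  rw [inv_inv]

/-- The wreath product of homomorphisms `f : N →* N'` and `g : T →* T'`, where `g` respects the
actions on the index set. -/
def map (f : N →* N') (g : T →* T') (hg : ∀ (t : T) (i : ι), g t • i = t • i) :
    PermWreath N ι T →* PermWreath N' ι T' :=
  SemidirectProduct.map (f.compLeft ι) g (by
    intro t
    ext a i
    change f (a (t⁻¹ • i)) = f (a ((g t)⁻¹ • i))
    rw [← map_inv, hg])

lemma map_injective (f : N →* N') (g : T →* T') (hg : ∀ (t : T) (i : ι), g t • i = t • i)
    (hf : Function.Injective f) (hg' : Function.Injective g) :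
    Function.Injective (map f g hg) := by
  intro x y hxy
  refine SemidirectProduct.ext (funext fun i => hf ?_) (hg' ?_)
  · exact congrFun (congrArg SemidirectProduct.left hxy) i
  · exact congrArg SemidirectProduct.right hxy

/-- The subgroup `(ker φ) ≀ T` of `N ≀ T`. -/
def kerWreath (φ : N →* A) (ι T : Type*) [Group T] [MulAction T ι] :
    Subgroup (PermWreath N ι T) where
  carrier := {x | ∀ i, φ (x.left i) = 1}
  one_mem' i := map_one φ
  mul_mem' {x y} hx hy i := by
    rw [mul_left_apply, map_mul, hx i, hy, one_mul]
  inv_mem' {x} hx i := by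
    rw [inv_left_apply, map_inv, hx, inv_one]

lemma card_kerWreath [Finite ι] (φ : N →* A) :
    Nat.card (kerWreath φ ι T) = Nat.card φ.ker ^ Nat.card ι * Nat.card T := by
  have := Fintype.ofFinite ι
  let e : kerWreath φ ι T ≃ (ι → φ.ker) × T :=
    { toFun := fun x => (fun i => ⟨x.1.left i, x.2 i⟩, x.1.right)
      invFun := fun y => ⟨⟨fun i => y.1 i, y.2⟩, fun i => (y.1 i).2⟩
      left_inv := fun x => rfl
      right_inv := fun y => rfl }
  rw [Nat.card_congr e, Nat.card_prod, Nat.card_fun]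

/-- If the finite set `s` is stable under `T`, the product over `s` of the values of `φ` at the
coordinates is a homomorphism on `N ≀ T`. -/
def prodHom (φ : N →* A) (s : Finset ι) (hs : ∀ (t : T), ∀ i ∈ s, t • i ∈ s) :
    PermWreath N ι T →* A where
  toFun x := ∏ i ∈ s, φ (x.left i)
  map_one' := Finset.prod_eq_one fun i _ => map_one φ
  map_mul' x y := by
    simp only [mul_left_apply, map_mul, Finset.prod_mul_distrib]
    congr 1
    refine Finset.prod_bij' (fun i _ => x.right⁻¹ • i) (fun i _ => x.right • i)
      (fun i hi => hs _ i hi) (fun i hi => hs _ i hi) ?_ ?_ ?_ <;> intros <;> simp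

lemma prodHom_apply (φ : N →* A) (s : Finset ι) (hs : ∀ (t : T), ∀ i ∈ s, t • i ∈ s)
    (x : PermWreath N ι T) : prodHom φ s hs x = ∏ i ∈ s, φ (x.left i) := rfl

lemma conj_inr_left_apply (x : PermWreath N ι T) (t : T) (i : ι) :
    (x * SemidirectProduct.inr t * x⁻¹).left i =
      x.left i * (x.left ((x.right * t * x.right⁻¹)⁻¹ • i))⁻¹ := by
  rw [mul_left_apply, mul_left_apply, inv_left_apply]
  simp [mul_smul]

/-- The normalizer of `(ker φ) ≀ T` is killed by `prodHom` as soon as `T` is transitive on `s` and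
`A` is killed by the size of `s`: commuting with `T` modulo `ker φ` forces the values of `φ` at the
coordinates in `s` to be equal. -/
lemma prodHom_eq_one_of_conj_mem (φ : N →* A) (s : Finset ι)
    (hs : ∀ (t : T), ∀ i ∈ s, t • i ∈ s) (htr : ∀ i ∈ s, ∀ j ∈ s, ∃ t : T, t • i = j)
    (hA : ∀ a : A, a ^ s.card = 1) (y : PermWreath N ι T)
    (hy : ∀ h ∈ kerWreath φ ι T, y * h * y⁻¹ ∈ kerWreath φ ι T) : prodHom φ s hs y = 1 := by
  have hconst : ∀ i ∈ s, ∀ j ∈ s, φ (y.left i) = φ (y.left j) := by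
    intro i hi j hj
    obtain ⟨t, ht⟩ := htr j hj i hi
    -- The top component of `y` is cancelled, so that the conjugate below permutes by `t`.
    have hmem : SemidirectProduct.inr (y.right⁻¹ * t * y.right) ∈ kerWreath φ ι T := by
      intro k
      simp
    have h := hy _ hmem i
    rw [conj_inr_left_apply, map_mul, map_inv, mul_inv_eq_one] at h
    rw [h]
    congr 2
    rw [← ht]
    simp [mul_assoc]
  rcases s.eq_empty_or_nonempty with rfl | ⟨i, hi⟩
  · simp [prodHom_apply]
  · rw [prodHom_apply, Finset.prod_congr rfl fun j hj => hconst j hj i hi, Finset.prod_const, hA]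

/-- If `T` stabilizes `s` and is transitive on it, `A` is killed by the size of `s`, and `φ` is
nontrivial, then `H = (ker φ) ≀ T` is not pronormal in `N ≀ T`. Conjugating by an element `g` with one
coordinate outside `ker φ`, both `H` and `H ^ g` lie in the kernel of `prodHom`, as does the
normalizer of `H`, whereas `g` does not. -/
lemma not_isPronormal_kerWreath (φ : N →* A) (s : Finset ι) (hne : s.Nonempty)
    (hs : ∀ (t : T), ∀ i ∈ s, t • i ∈ s) (htr : ∀ i ∈ s, ∀ j ∈ s, ∃ t : T, t • i = j)
    (hA : ∀ a : A, a ^ s.card = 1) (hφ : ∃ x, φ x ≠ 1) :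
    ¬ IsPronormal (kerWreath φ ι T) := by
  classical
  intro hpro
  obtain ⟨i, hi⟩ := hne
  obtain ⟨u, hu⟩ := hφ
  set g : PermWreath N ι T := SemidirectProduct.inl (Pi.mulSingle i u) with hg
  have hχg : prodHom φ s hs g = φ u := by
    rw [prodHom_apply, Finset.prod_eq_single_of_mem i hi]
    · simp [hg]
    · intro j _ hj
      simp [hg, Pi.mulSingle_eq_of_ne hj]
  have hker : kerWreath φ ι T ≤ (prodHom φ s hs).ker := fun x hx =>
    Finset.prod_eq_one fun j _ => hx j
  have hker' : conjSubgroup (kerWreath φ ι T) g ≤ (prodHom φ s hs).ker := by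
    intro x hx
    have := hker (mem_conjSubgroup.1 hx)
    rw [MonoidHom.mem_ker] at this ⊢
    simpa using this
  obtain ⟨x, hx, hxg⟩ := hpro g
  have hχx : prodHom φ s hs x = 1 := sup_le hker hker' hx
  have hnorm : prodHom φ s hs (g * x⁻¹) = 1 := by
    refine prodHom_eq_one_of_conj_mem φ s hs htr hA _ fun h hh => ?_
    have h1 : x⁻¹ * h * x ∈ conjSubgroup (kerWreath φ ι T) x := by
      rw [mem_conjSubgroup]
      simpa [mul_assoc] using hh
    rw [hxg, mem_conjSubgroup] at h1
    simpa [mul_assoc] using h1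
  rw [map_mul, map_inv, hχx, hχg, inv_one, mul_one] at hnorm
  exact hu hnorm

end PermWreath

/-! ### Odd binomial coefficients `n.choose m` with `3 ∣ m` -/

lemma Nat.odd_choose_two_mul {n m : ℕ} : Odd ((2 * n).choose (2 * m)) ↔ Odd (n.choose m) := by
  have := Fact.mk Nat.prime_two
  have h := Choose.choose_modEq_choose_mod_mul_choose_div_nat (n := 2 * n) (k := 2 * m) (p := 2)
  simp [Nat.ModEq] at h
  rw [Nat.odd_iff, Nat.odd_iff, h]

lemma Nat.odd_choose_two_mul_add_one {n m : ℕ} :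
    Odd ((2 * n + 1).choose (2 * m)) ↔ Odd (n.choose m) := by
  have := Fact.mk Nat.prime_two
  have h := Choose.choose_modEq_choose_mod_mul_choose_div_nat (n := 2 * n + 1) (k := 2 * m) (p := 2)
  have h1 : (2 * n + 1) / 2 = n := by omega
  simp [Nat.ModEq, h1] at h
  rw [Nat.odd_iff, Nat.odd_iff, h]

lemma Nat.odd_choose_two_mul_add_one' {n m : ℕ} :
    Odd ((2 * n + 1).choose (2 * m + 1)) ↔ Odd (n.choose m) := by
  have := Fact.mk Nat.prime_two
  have h := Choose.choose_modEq_choose_mod_mul_choose_div_nat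
    (n := 2 * n + 1) (k := 2 * m + 1) (p := 2)
  have h1 : (2 * n + 1) / 2 = n := by omega
  have h2 : (2 * m + 1) / 2 = m := by omega
  simp [Nat.ModEq, h1, h2] at h
  rw [Nat.odd_iff, Nat.odd_iff, h]

lemma Nat.odd_choose_two_pow_mul (w : ℕ) {n m : ℕ} (h : Odd (n.choose m)) :
    Odd ((2 ^ w * n).choose (2 ^ w * m)) := by
  induction w with
  | zero => simpa
  | succ w ih => rwa [pow_succ', mul_assoc, mul_assoc, Nat.odd_choose_two_mul]

lemma Nat.two_pow_mod_three (e : ℕ) : 2 ^ e % 3 = if Even e then 1 else 2 := by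
  induction e with
  | zero => rfl
  | succ e ih =>
    rw [pow_succ, Nat.mul_mod, ih]
    by_cases he : Even e <;> simp [he, Nat.even_add_one]

/-- By Lucas, the `m` with `n.choose m` odd are the sums of sets of binary digits `2 ^ a` of `n`,
and `2 ^ a ≡ ± 1` modulo `3` by the parity of `a`. So such an `m` can be a positive multiple of
`3` unless `n` has a single binary digit, or two at an even distance. -/
lemma exists_odd_choose_three_dvd (n : ℕ) (hn : 1 ≤ n) (hn₁ : ¬ ∃ w : ℕ, n = 2 ^ w)
    (hn₂ : ¬ ∃ w k : ℕ, n = 2 ^ w * (2 ^ (2 * k) + 1)) :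
    ∃ m, 0 < m ∧ m ≤ n ∧ 3 ∣ m ∧ Odd (n.choose m) := by
  induction n using Nat.strong_induction_on with
  | _ n ih =>
  obtain ⟨r, rfl | rfl⟩ := Nat.even_or_odd' n
  · obtain ⟨m, h0, h1, h2, h3⟩ := ih r (by omega) (by omega)
      (fun ⟨w, hw⟩ => hn₁ ⟨w + 1, by rw [hw]; ring⟩)
      (fun ⟨w, k, hw⟩ => hn₂ ⟨w + 1, k, by rw [hw]; ring⟩)
    exact ⟨2 * m, by omega, by omega, by omega, Nat.odd_choose_two_mul.2 h3⟩
  have hr : 1 ≤ r := by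
    by_contra h
    exact hn₁ ⟨0, by simp; omega⟩
  -- `m = n` is a valid choice as soon as `3 ∣ n`.
  have self : 3 ∣ 2 * r + 1 → ∃ m, 0 < m ∧ m ≤ 2 * r + 1 ∧ 3 ∣ m ∧ Odd ((2 * r + 1).choose m) :=
    fun h => ⟨2 * r + 1, by omega, le_rfl, h, by simp⟩
  have hpow : ∀ w, r = 2 ^ w → 3 ∣ 2 * r + 1 := by
    intro w hw
    have h1 := Nat.two_pow_mod_three w
    split_ifs at h1 with hw2
    · omega
    · obtain ⟨k, rfl⟩ := Nat.not_even_iff_odd.1 hw2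
      exact absurd ⟨0, k + 1, by rw [hw]; ring⟩ hn₂
  by_cases c₁ : ∃ w : ℕ, r = 2 ^ w
  · exact self (hpow _ c₁.choose_spec)
  by_cases c₂ : ∃ w k : ℕ, r = 2 ^ w * (2 ^ (2 * k) + 1)
  · obtain ⟨w, k, hw⟩ := c₂
    have h1 := Nat.two_pow_mod_three w
    have h2 := Nat.two_pow_mod_three (2 * k)
    rw [if_pos (even_two_mul k)] at h2
    have h3 : r % 3 = (2 ^ w % 3 * 2) % 3 := by
      rw [hw, Nat.mul_mod, Nat.add_mod, h2]
    split_ifs at h1 with hw2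
    · -- The digits are `2 ^ (w + 2 * k + 1)`, `2 ^ (w + 1)` and `1`; the last two sum to `m`.
      have hk : k ≠ 0 := by
        rintro rfl
        exact c₁ ⟨w + 1, by rw [hw]; ring⟩
      have hodd : Odd ((2 ^ w * (2 ^ (2 * k) + 1)).choose (2 ^ w * 1)) := by
        apply Nat.odd_choose_two_pow_mul
        rw [Nat.choose_one_right]
        exact (Nat.even_pow.2 ⟨even_two, by omega⟩).add_one
      rw [← hw, mul_one] at hodd
      have hle : 2 ^ w ≤ r := by rw [hw]; exact Nat.le_mul_of_pos_right _ (by positivity)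
      exact ⟨2 * 2 ^ w + 1, by omega, by omega, by omega, Nat.odd_choose_two_mul_add_one'.2 hodd⟩
    · exact self (by omega)
  · obtain ⟨m, h0, h1, h2, h3⟩ := ih r (by omega) hr c₁ c₂
    exact ⟨2 * m, by omega, by omega, by omega, Nat.odd_choose_two_mul_add_one.2 h3⟩

/-! ### Normalized quaternion groups -/

/-- The group generated by `i` and `j` is a `2`-group because `j` normalizes the powers of `i`, and
its order is divisible by `8` because it properly contains the subgroup of order `4` generated by
`i`. -/
lemma isPGroup_closure_quaternion {S : Type*} [Group S] [Finite S] {i j : S} (hi2 : i ^ 2 ≠ 1)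
    (hi : i ^ 4 = 1) (hj : j ^ 4 = 1) (hij : j * i * j⁻¹ = i⁻¹) :
    IsPGroup 2 (Subgroup.closure {i, j}) ∧ 8 ∣ Nat.card (Subgroup.closure {i, j}) := by
  have := Fact.mk Nat.prime_two
  have hor : orderOf i = 4 :=
    orderOf_eq_prime_pow (p := 2) (n := 1) (by simpa using hi2) (by simpa using hi)
  have hp : ∀ x : S, x ^ 4 = 1 → IsPGroup 2 (Subgroup.zpowers x) := by
    intro x hx
    rw [IsPGroup.iff_orderOf]
    rintro ⟨_, k, rfl⟩
    have h1 : orderOf (⟨x ^ k, ⟨k, rfl⟩⟩ : Subgroup.zpowers x) ∣ 2 ^ 2 := by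
      apply orderOf_dvd_of_pow_eq_one
      ext
      change (x ^ k) ^ 4 = 1
      rw [← zpow_natCast, ← zpow_mul, mul_comm, zpow_mul, zpow_natCast, hx, one_zpow]
    obtain ⟨k, -, hk⟩ := (Nat.dvd_prime_pow Nat.prime_two).1 h1
    exact ⟨k, hk⟩
  have hnorm : Subgroup.zpowers j ≤ Subgroup.normalizer (Subgroup.zpowers i : Set S) := by
    rw [Subgroup.zpowers_le, Subgroup.mem_normalizer_iff]
    have h1 : (Subgroup.zpowers i).map (MulAut.conj j).toMonoidHom = Subgroup.zpowers i := by
      rw [MonoidHom.map_zpowers]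
      simp [hij]
    intro x
    constructor
    · intro hx
      rw [← h1]
      exact ⟨x, hx, rfl⟩
    · intro hx
      rw [← h1] at hx
      obtain ⟨y, hy, hyx⟩ := hx
      have : y = x := (MulAut.conj j).injective hyx
      exact this ▸ hy
  have hQ : Subgroup.closure {i, j} = Subgroup.zpowers j ⊔ Subgroup.zpowers i := by
    rw [Set.pair_comm, Set.insert_eq, Subgroup.closure_union, Subgroup.zpowers_eq_closure,
      Subgroup.zpowers_eq_closure]
  have hQp : IsPGroup 2 (Subgroup.closure {i, j}) := by
    rw [hQ]
    exact (hp j hj).to_sup_of_normal_right' (hp i hi) hnorm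
  refine ⟨hQp, ?_⟩
  have hle : Subgroup.zpowers i ≤ Subgroup.closure {i, j} := hQ ▸ le_sup_right
  have hjn : j ∉ Subgroup.zpowers i := by
    rintro ⟨k, rfl⟩
    apply hi2
    have : i = i⁻¹ := ((Commute.refl i).zpow_left k).mul_inv_cancel.symm.trans hij
    rw [sq, mul_eq_one_iff_eq_inv]
    exact this
  obtain ⟨k, hk⟩ := IsPGroup.iff_card.1 hQp
  have h4 : Nat.card (Subgroup.zpowers i) = 4 := by rw [Nat.card_zpowers, hor]
  have hlt : 4 < 2 ^ k := by
    rw [← hk, ← h4]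
    refine lt_of_le_of_ne (Subgroup.card_le_of_le hle) fun heq => hjn ?_
    rw [Subgroup.eq_of_le_of_card_ge hle heq.ge]
    exact Subgroup.subset_closure (by simp)
  have : 3 ≤ k := by
    by_contra hk3
    have : 2 ^ k ≤ 2 ^ 2 := Nat.pow_le_pow_right (by omega) (by omega)
    omega
  rw [hk]
  exact pow_dvd_pow 2 this

/-- If an element `w` of order `3` permutes the quaternion units `i`, `j`, `i * j` cyclically by
conjugation, then the quaternion group `Q` is the kernel of a nontrivial homomorphism from a group
(the extension of `Q` by `w`) to a group of exponent `3`. -/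
lemma exists_hom_ker_map_eq_quaternion.{u} {S : Type u} [Group S] [Finite S] {i j w : S}
    (hi2 : i ^ 2 ≠ 1) (hi : i ^ 4 = 1) (hj : j ^ 4 = 1) (hij : j * i * j⁻¹ = i⁻¹)
    (hw3 : w ^ 3 = 1) (hw1 : w ≠ 1) (hwi : w * i * w⁻¹ = j) (hwj : w * j * w⁻¹ = i * j) :
    ∃ (N A : Type u) (_ : Group N) (_ : CommGroup A) (f : N →* S) (φ : N →* A),
      Function.Injective f ∧ φ.ker.map f = Subgroup.closure {i, j} ∧
      (∀ a : A, a ^ 3 = 1) ∧ ∃ x, φ x ≠ 1 := by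
  set Q := Subgroup.closure {i, j} with hQdef
  have hQ : IsPGroup 2 Q := (isPGroup_closure_quaternion hi2 hi hj hij).1
  have hiQ : i ∈ Q := Subgroup.subset_closure (by simp)
  have hjQ : j ∈ Q := Subgroup.subset_closure (by simp)
  have hmap : Q.map (MulAut.conj w).toMonoidHom = Q := by
    apply Subgroup.eq_of_le_of_card_ge
    · rw [hQdef, MonoidHom.map_closure, Subgroup.closure_le]
      rintro _ ⟨x, rfl | rfl, rfl⟩
      · simpa [hwi] using hjQ
      · simpa [hwj] using Q.mul_mem hiQ hjQ
    · rw [Subgroup.card_map_of_injective (MulAut.conj w).injective]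
  have hw : w ∈ Subgroup.normalizer (Q : Set S) := by
    rw [Subgroup.mem_normalizer_iff]
    intro x
    constructor
    · intro hx
      rw [← hmap]
      exact ⟨x, hx, rfl⟩
    · intro hx
      rw [← hmap] at hx
      obtain ⟨y, hy, hyx⟩ := hx
      have : y = x := (MulAut.conj w).injective hyx
      exact this ▸ hy
  have hwQ : w ∉ Q := by
    intro h
    obtain ⟨k, hk⟩ := hQ ⟨w, h⟩
    have hk' : w ^ 2 ^ k = 1 := congrArg Subtype.val hk
    have h1 : orderOf w ∣ Nat.gcd (2 ^ k) 3 :=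
      Nat.dvd_gcd (orderOf_dvd_of_pow_eq_one hk') (orderOf_dvd_of_pow_eq_one hw3)
    rw [Nat.Coprime.pow_left k (by norm_num : Nat.Coprime 2 3), Nat.dvd_one,
      orderOf_eq_one_iff] at h1
    exact hw1 h1
  let M := Subgroup.normalizer (Q : Set S)
  let π : M →* M ⧸ Q.subgroupOf M := QuotientGroup.mk' _
  let C := Subgroup.zpowers (π ⟨w, hw⟩)
  have hπw : π ⟨w, hw⟩ ^ 3 = 1 := by
    rw [← map_pow, ← map_one π]
    exact congrArg π (Subtype.ext hw3)
  have hQM : Q ≤ M := Subgroup.le_normalizer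
  have hπ : ∀ x, π x = 1 ↔ (x : S) ∈ Q := fun x => QuotientGroup.eq_one_iff x
  refine ⟨C.comap π, C, inferInstance,
    { (inferInstance : Group C) with mul_comm := mul_comm' }, M.subtype.comp (C.comap π).subtype,
    π.subgroupComap C, ?_, ?_, ?_, ?_⟩
  · exact M.subtype_injective.comp (C.comap π).subtype_injective
  · ext x
    constructor
    · rintro ⟨y, hy, rfl⟩
      exact (hπ y.1).1 (congrArg Subtype.val hy)
    · intro hx
      have h1 : π ⟨x, hQM hx⟩ = 1 := (hπ _).2 hx
      exact ⟨⟨⟨x, hQM hx⟩, by rw [Subgroup.mem_comap, h1]; exact C.one_mem⟩, Subtype.ext h1, rfl⟩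
  · rintro ⟨_, k, rfl⟩
    ext
    change (π ⟨w, hw⟩ ^ k) ^ 3 = 1
    rw [← zpow_natCast, ← zpow_mul, mul_comm, zpow_mul, zpow_natCast, hπw, one_zpow]
  · refine ⟨⟨⟨w, hw⟩, Subgroup.mem_zpowers _⟩, fun h => hwQ ?_⟩
    exact (hπ ⟨w, hw⟩).1 (congrArg Subtype.val h)

open Matrix
open scoped MatrixGroups Pointwise

/-! ### A subgroup of odd index in `SL(2, K)` -/

/-- The special linear group is the kernel of the surjection `det` on `GL (Fin 2) K`. -/
lemma card_SL_two (K : Type*) [Field K] [Finite K] :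
    Nat.card SL(2, K) = (Nat.card K ^ 2 - 1) * Nat.card K := by
  have := Fintype.ofFinite K
  have hGL := card_GL_field (𝔽 := K) 2
  simp only [Fin.prod_univ_two, Fin.val_zero, Fin.val_one, pow_zero, pow_one,
    ← Nat.card_eq_fintype_card] at hGL
  have hinj : Function.Injective (Matrix.SpecialLinearGroup.toGL (n := Fin 2) (R := K)) :=
    Matrix.SpecialLinearGroup.toGL_injective
  have hrange : (Matrix.SpecialLinearGroup.toGL (n := Fin 2) (R := K)).range =
      (GeneralLinearGroup.det (n := Fin 2) (R := K)).ker := by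
    ext x
    constructor
    · rintro ⟨y, rfl⟩
      ext
      simp
    · intro hx
      refine ⟨⟨x.1, congrArg Units.val hx⟩, ?_⟩
      ext
      rfl
  have hsurj : Function.Surjective (GeneralLinearGroup.det (n := Fin 2) (R := K)) := by
    intro u
    refine ⟨GeneralLinearGroup.mkOfDetNeZero !![(u : K), 0; 0, 1] (by simp), ?_⟩
    ext
    simp [GeneralLinearGroup.mkOfDetNeZero]
  have h1 := (GeneralLinearGroup.det (n := Fin 2) (R := K)).ker.card_mul_index
  rw [Subgroup.index_ker, MonoidHom.range_eq_top_of_surjective _ hsurj, Subgroup.card_top,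
    ← hrange, hGL, Nat.card_units,
    ← Nat.card_congr (MonoidHom.ofInjective hinj).toEquiv] at h1
  have hq : 1 < Nat.card K := Finite.one_lt_card
  have h2 : Nat.card K ^ 2 - Nat.card K = Nat.card K * (Nat.card K - 1) := by
    rw [Nat.mul_sub, mul_one, sq]
  rw [h2, ← mul_assoc] at h1
  exact Nat.eq_of_mul_eq_mul_right (by omega) h1

/-- A subgroup of `SL(2, K)` of order divisible by `8` has odd index when `|K| ≡ ±3` modulo `8`. -/
lemma odd_index_of_eight_dvd_card {K : Type*} [Field K] [Finite K]
    (hq : Nat.card K % 8 = 3 ∨ Nat.card K % 8 = 5) (Q : Subgroup SL(2, K))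
    (hQ : 8 ∣ Nat.card Q) : Odd Q.index := by
  obtain ⟨c, hc⟩ := hQ
  have h := Q.card_mul_index
  rw [card_SL_two, hc] at h
  have hodd : Odd (c * Q.index) := by
    rw [Nat.odd_iff]
    have hmod : ((Nat.card K ^ 2 - 1) * Nat.card K) % 16 = 8 := by
      generalize Nat.card K = q at hq
      obtain ⟨t, ht⟩ : ∃ t, q ^ 2 - 1 = 16 * t + 8 := by
        rcases hq with hq | hq
        · obtain ⟨s, rfl⟩ : ∃ s, q = 8 * s + 3 := ⟨q / 8, by omega⟩
          exact ⟨4 * s ^ 2 + 3 * s, by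
            rw [Nat.sub_eq_iff_eq_add (Nat.one_le_pow _ _ (by omega))]; ring⟩
        · obtain ⟨s, rfl⟩ : ∃ s, q = 8 * s + 5 := ⟨q / 8, by omega⟩
          exact ⟨4 * s ^ 2 + 5 * s + 1, by
            rw [Nat.sub_eq_iff_eq_add (Nat.one_le_pow _ _ (by omega))]; ring⟩
      rw [ht]
      obtain ⟨s, rfl⟩ : ∃ s, q = 2 * s + 1 := ⟨q / 2, by omega⟩
      have : (16 * t + 8) * (2 * s + 1) = 16 * (2 * t * s + t + s) + 8 := by ring
      omega
    rw [← h, mul_assoc] at hmod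
    omega
  exact (Nat.odd_mul.1 hodd).2

lemma FiniteField.exists_sq_add_sq_eq_neg_one (K : Type*) [Field K] [Finite K] :
    ∃ a b : K, a ^ 2 + b ^ 2 = -1 := by
  have := Fintype.ofFinite K
  have := Fact.mk (CharP.char_is_prime K (ringChar K))
  have : NeZero (ringChar K) := ⟨(CharP.char_is_prime K (ringChar K)).ne_zero⟩
  obtain ⟨a, b, h⟩ := CharP.sq_add_sq K (ringChar K) (-1)
  exact ⟨a, b, by simpa using h⟩

/-- The quarter turn of a plane, of order `4` when `K` has odd characteristic. -/
def quarterTurn (K : Type*) [Field K] : SL(2, K) := ⟨!![0, 1; -1, 0], by simp⟩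

lemma quarterTurn_sq (K : Type*) [Field K] : quarterTurn K ^ 2 = -1 := by
  refine Matrix.SpecialLinearGroup.ext _ _ fun i j => ?_
  rw [sq, Matrix.SpecialLinearGroup.coe_mul]
  fin_cases i <;> fin_cases j <;> simp [quarterTurn]


lemma two_ne_zero_of_odd_card {K : Type*} [Field K] [Finite K] (h : Odd (Nat.card K)) :
    (2 : K) ≠ 0 := by
  have := Fintype.ofFinite K
  apply Ring.two_ne_zero
  intro h2
  rw [FiniteField.even_card_iff_char_two, ← Nat.card_eq_fintype_card] at h2
  rw [Nat.odd_iff] at h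
  omega

/-- When `|K| ≡ ±3` modulo `8`, the group `SL(2, K)` has a subgroup of odd index, namely a
quaternion group containing the center, that is the kernel of a nontrivial homomorphism from an
overgroup (isomorphic to `SL(2, 3)`) to a group of exponent `3`. -/
lemma exists_hom_odd_index_map_ker.{u} (K : Type u) [Field K] [Finite K]
    (hq : Nat.card K % 8 = 3 ∨ Nat.card K % 8 = 5) :
    ∃ (N A : Type u) (_ : Group N) (_ : CommGroup A) (f : N →* SL(2, K)) (φ : N →* A),
      Function.Injective f ∧ Odd (φ.ker.map f).index ∧
      Subgroup.center SL(2, K) ≤ φ.ker.map f ∧ (∀ a : A, a ^ 3 = 1) ∧ ∃ x, φ x ≠ 1 := by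
  have h2 : (2 : K) ≠ 0 := two_ne_zero_of_odd_card (Nat.odd_iff.2 (by omega))
  obtain ⟨a, b, hab⟩ := FiniteField.exists_sq_add_sq_eq_neg_one K
  let j : SL(2, K) := ⟨!![a, b; b, -a], by rw [det_fin_two_of]; linear_combination -hab⟩
  -- The Hurwitz unit `-(1 + i + j + i * j) / 2`.
  let u : SL(2, K) := ⟨(-1 / 2 : K) • !![1 + a + b, 1 - a + b; -1 - a + b, 1 - a - b], by
    rw [det_smul, det_fin_two_of, Fintype.card_fin]
    field_simp
    linear_combination -2 * hab⟩
  have hneg : (-1 : SL(2, K)) ≠ 1 := by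
    intro h
    have h1 : (-1 : K) = 1 := by simpa using congrArg (fun A : SL(2, K) => A 0 0) h
    exact h2 (by linear_combination -h1)
  have hi2 := quarterTurn_sq K
  have hj2 : j ^ 2 = -1 := by
    refine Matrix.SpecialLinearGroup.ext _ _ fun k l => ?_
    rw [sq, Matrix.SpecialLinearGroup.coe_mul]
    fin_cases k <;> fin_cases l <;> simp [j] <;> grind
  have h4 : ∀ x : SL(2, K), x ^ 2 = -1 → x ^ 4 = 1 := fun x hx => by
    rw [show 4 = 2 * 2 from rfl, pow_mul, hx, neg_one_sq]
  have hij : j * quarterTurn K * j⁻¹ = (quarterTurn K)⁻¹ := by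
    rw [mul_inv_eq_iff_eq_mul, eq_inv_mul_iff_mul_eq]
    refine Matrix.SpecialLinearGroup.ext _ _ fun k l => ?_
    simp only [Matrix.SpecialLinearGroup.coe_mul]
    fin_cases k <;> fin_cases l <;> simp [j, quarterTurn]
  have hui : u * quarterTurn K * u⁻¹ = j := by
    rw [mul_inv_eq_iff_eq_mul]
    refine Matrix.SpecialLinearGroup.ext _ _ fun k l => ?_
    simp only [Matrix.SpecialLinearGroup.coe_mul]
    fin_cases k <;> fin_cases l <;> simp [j, quarterTurn, u, Matrix.mul_apply] <;> field_simp <;>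
      grind
  have huj : u * j * u⁻¹ = quarterTurn K * j := by
    rw [mul_inv_eq_iff_eq_mul]
    refine Matrix.SpecialLinearGroup.ext _ _ fun k l => ?_
    simp only [Matrix.SpecialLinearGroup.coe_mul]
    fin_cases k <;> fin_cases l <;> simp [j, quarterTurn, u] <;> field_simp <;>
      grind
  have hu1 : u ≠ 1 := by
    rintro h
    have h1 : quarterTurn K = 1 := by simpa [h] using huj
    apply hneg
    rw [← hi2, h1, one_pow]
  have hu2 : u.1 * u.1 = -u.1 - 1 := by
    ext k l
    fin_cases k <;> fin_cases l <;> simp [u] <;> field_simp <;> grind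
  have hu3 : u ^ 3 = 1 := by
    refine Subtype.ext ?_
    rw [Matrix.SpecialLinearGroup.coe_pow, pow_succ, sq, hu2, sub_mul, neg_mul, hu2]
    simp
  obtain ⟨N, A, hN, hA, f, φ, hf, hker, hA3, hφ⟩ := exists_hom_ker_map_eq_quaternion
    (by rw [hi2]; exact hneg) (h4 _ hi2) (h4 _ hj2) hij hu3 hu1 hui huj
  refine ⟨N, A, hN, hA, f, φ, hf, ?_, ?_, hA3, hφ⟩
  · rw [hker]
    exact odd_index_of_eight_dvd_card hq _
      (isPGroup_closure_quaternion (by rw [hi2]; exact hneg) (h4 _ hi2) (h4 _ hj2) hij).2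
  · intro x hx
    rw [hker]
    obtain ⟨r, hr, hrx⟩ := Matrix.SpecialLinearGroup.mem_center_iff.1 hx
    rw [Fintype.card_fin, sq_eq_one_iff] at hr
    rcases hr with rfl | rfl
    · have : x = 1 := by
        refine Matrix.SpecialLinearGroup.ext _ _ fun k l => ?_
        rw [← hrx]
        simp
      exact this ▸ Subgroup.one_mem _
    · have : x = quarterTurn K ^ 2 := by
        rw [hi2]
        refine Matrix.SpecialLinearGroup.ext _ _ fun k l => ?_
        rw [← hrx]
        fin_cases k <;> fin_cases l <;> simp
      exact this ▸ Subgroup.pow_mem _ (Subgroup.subset_closure (by simp)) 2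

/-! ### The symplectic group in terms of `2 × 2` blocks -/

section Blocks

variable {ι K : Type*}

/-- The `2 × 2` block of a `(ι ⊕ ι) × (ι ⊕ ι)` matrix with rows `inl i, inr i` and columns
`inl k, inr k`, that is, its component between the `k`-th and the `i`-th hyperbolic planes. -/
def planeBlock (A : Matrix (ι ⊕ ι) (ι ⊕ ι) K) (i k : ι) : Matrix (Fin 2) (Fin 2) K :=
  !![A (.inl i) (.inl k), A (.inl i) (.inr k); A (.inr i) (.inl k), A (.inr i) (.inr k)]

/-- The `(ι ⊕ ι) × (ι ⊕ ι)` matrix with given plane blocks. -/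
def ofPlaneBlocks (B : ι → ι → Matrix (Fin 2) (Fin 2) K) : Matrix (ι ⊕ ι) (ι ⊕ ι) K :=
  fromBlocks (of fun i k => B i k 0 0) (of fun i k => B i k 0 1)
    (of fun i k => B i k 1 0) (of fun i k => B i k 1 1)

lemma planeBlock_ofPlaneBlocks (B : ι → ι → Matrix (Fin 2) (Fin 2) K) (i k : ι) :
    planeBlock (ofPlaneBlocks B) i k = B i k := by
  ext a b
  fin_cases a <;> fin_cases b <;> simp [planeBlock, ofPlaneBlocks]

lemma ext_planeBlock {A B : Matrix (ι ⊕ ι) (ι ⊕ ι) K}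
    (h : ∀ i k, planeBlock A i k = planeBlock B i k) : A = B := by
  ext (i | i) (k | k)
  · exact congrFun₂ (h i k) 0 0
  · exact congrFun₂ (h i k) 0 1
  · exact congrFun₂ (h i k) 1 0
  · exact congrFun₂ (h i k) 1 1

variable [Field K]

lemma planeBlock_mul [Fintype ι] (A B : Matrix (ι ⊕ ι) (ι ⊕ ι) K) (i k : ι) :
    planeBlock (A * B) i k = ∑ j, planeBlock A i j * planeBlock B j k := by
  ext a b
  fin_cases a <;> fin_cases b <;>
    simp [planeBlock, Matrix.mul_apply, Matrix.sum_apply, Finset.sum_add_distrib]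

lemma planeBlock_one [DecidableEq ι] (i k : ι) :
    planeBlock (1 : Matrix (ι ⊕ ι) (ι ⊕ ι) K) i k = if i = k then 1 else 0 := by
  ext a b
  split_ifs with h <;> fin_cases a <;> fin_cases b <;> simp [planeBlock, Matrix.one_apply, h]

/-- The block-monomial matrix of an element of `SL(2, K) ≀ Perm ι`. -/
def monomialMatrix [DecidableEq ι] (x : PermWreath SL(2, K) ι (Equiv.Perm ι)) :
    Matrix (ι ⊕ ι) (ι ⊕ ι) K :=
  ofPlaneBlocks fun i k => if i = x.right k then (x.left i : Matrix (Fin 2) (Fin 2) K) else 0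

lemma planeBlock_monomialMatrix [DecidableEq ι] (x : PermWreath SL(2, K) ι (Equiv.Perm ι))
    (i k : ι) :
    planeBlock (monomialMatrix x) i k =
      if i = x.right k then (x.left i : Matrix (Fin 2) (Fin 2) K) else 0 := by
  rw [monomialMatrix, planeBlock_ofPlaneBlocks]

variable [Fintype ι] [DecidableEq ι]

/-- The symplectic adjoint of a matrix has as blocks the adjugates of the transposed blocks. -/
lemma planeBlock_adjoint (A : Matrix (ι ⊕ ι) (ι ⊕ ι) K) (i k : ι) :
    planeBlock (-J ι K * Aᵀ * J ι K) i k = (planeBlock A k i).adjugate := by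
  have h : -J ι K * Aᵀ * J ι K =
      fromBlocks A.toBlocks₂₂ᵀ (-A.toBlocks₁₂ᵀ) (-A.toBlocks₂₁ᵀ) A.toBlocks₁₁ᵀ := by
    conv_lhs => rw [← fromBlocks_toBlocks A]
    simp [J, fromBlocks_transpose, fromBlocks_multiply, fromBlocks_neg]
  rw [h, adjugate_fin_two]
  ext a b
  fin_cases a <;> fin_cases b <;>
    simp [planeBlock, toBlocks₁₁, toBlocks₁₂, toBlocks₂₁, toBlocks₂₂]

lemma planeBlock_inv (g : symplecticGroup ι K) (i k : ι) :
    planeBlock (g⁻¹ : symplecticGroup ι K).1 i k = (planeBlock g.1 k i).adjugate := by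
  rw [SymplecticGroup.coe_inv, planeBlock_adjoint]

/-- A matrix is symplectic if its blocks are unitary for the involution `adjugate`. -/
lemma mem_symplecticGroup_of_planeBlock {A : Matrix (ι ⊕ ι) (ι ⊕ ι) K}
    (h : ∀ i k, ∑ j, planeBlock A i j * (planeBlock A k j).adjugate = if i = k then 1 else 0) :
    A ∈ symplecticGroup ι K := by
  have h1 : A * (-J ι K * Aᵀ * J ι K) = 1 := by
    refine ext_planeBlock fun i k => ?_
    rw [planeBlock_mul, planeBlock_one, ← h]
    simp only [planeBlock_adjoint]
  rw [mul_eq_one_comm] at h1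
  rw [SymplecticGroup.mem_iff']
  calc Aᵀ * J ι K * A = -(J ι K * J ι K) * (Aᵀ * J ι K * A) := by rw [J_squared]; simp
    _ = J ι K * ((-J ι K * Aᵀ * J ι K) * A) := by simp [Matrix.mul_assoc]
    _ = J ι K := by rw [h1, Matrix.mul_one]

lemma sum_planeBlock_mul_adjugate (g : symplecticGroup ι K) (i k : ι) :
    ∑ j, planeBlock g.1 i j * (planeBlock g.1 k j).adjugate = if i = k then 1 else 0 := by
  rw [← planeBlock_one, ← Submonoid.coe_one (symplecticGroup ι K), ← mul_inv_cancel g,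
    Submonoid.coe_mul, planeBlock_mul]
  simp only [planeBlock_inv]

lemma sum_adjugate_mul_planeBlock (g : symplecticGroup ι K) (i k : ι) :
    ∑ j, (planeBlock g.1 j i).adjugate * planeBlock g.1 j k = if i = k then 1 else 0 := by
  rw [← planeBlock_one, ← Submonoid.coe_one (symplecticGroup ι K), ← inv_mul_cancel g,
    Submonoid.coe_mul, planeBlock_mul]
  simp only [planeBlock_inv]

/-! ### The stabilizer of an orthogonal decomposition into hyperbolic planes -/

lemma monomialMatrix_mem (x : PermWreath SL(2, K) ι (Equiv.Perm ι)) :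
    monomialMatrix x ∈ symplecticGroup ι K := by
  refine mem_symplecticGroup_of_planeBlock fun i k => ?_
  have apply_inv : x.right (x.right⁻¹ i) = i := x.right.apply_symm_apply i
  rw [Finset.sum_eq_single (x.right⁻¹ i)]
  · simp only [planeBlock_monomialMatrix, apply_inv, if_true]
    by_cases h : i = k
    · subst h
      simp [mul_adjugate]
    · simp [h, Ne.symm h]
  · intro j _ hj
    rw [planeBlock_monomialMatrix, if_neg, Matrix.zero_mul]
    rintro rfl
    simp at hj
  · simp

/-- The embedding of `SL(2, K) ≀ Perm ι` into the symplectic group, whose image is the stabilizer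
of the standard decomposition into hyperbolic planes. -/
def monomialHom (ι K : Type*) [Fintype ι] [DecidableEq ι] [Field K] :
    PermWreath SL(2, K) ι (Equiv.Perm ι) →* symplecticGroup ι K :=
  MonoidHom.mk' (fun x => ⟨monomialMatrix x, monomialMatrix_mem x⟩) (by
    intro x y
    refine Subtype.ext (ext_planeBlock fun i k => ?_)
    simp only [Submonoid.coe_mul, planeBlock_mul, planeBlock_monomialMatrix]
    have apply_inv : x.right (x.right⁻¹ i) = i := x.right.apply_symm_apply i
    rw [Finset.sum_eq_single (x.right⁻¹ i)]
    · have h : x.right⁻¹ i = y.right k ↔ i = x.right (y.right k) := Equiv.Perm.inv_eq_iff_eq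
      simp only [apply_inv, if_true, SemidirectProduct.mul_right,
        Equiv.Perm.mul_apply, h, mul_ite, Matrix.mul_zero, PermWreath.mul_left_apply,
        Matrix.SpecialLinearGroup.coe_mul, Equiv.Perm.smul_def]
      rfl
    · intro j _ hj
      rw [if_neg, Matrix.zero_mul]
      rintro rfl
      simp at hj
    · simp)

lemma planeBlock_monomialHom (x : PermWreath SL(2, K) ι (Equiv.Perm ι)) (i k : ι) :
    planeBlock (monomialHom ι K x).1 i k =
      if i = x.right k then (x.left i : Matrix (Fin 2) (Fin 2) K) else 0 :=
  planeBlock_monomialMatrix x i k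

lemma monomialHom_injective : Function.Injective (monomialHom ι K) := by
  rw [injective_iff_map_eq_one]
  intro x hx
  have h : ∀ i k, (if i = x.right k then (x.left i : Matrix (Fin 2) (Fin 2) K) else 0) =
      if i = k then 1 else 0 := by
    intro i k
    rw [← planeBlock_monomialHom, hx, Submonoid.coe_one, planeBlock_one]
  have hr : ∀ k, x.right k = k := by
    intro k
    by_contra hk
    have h1 := h k k
    rw [if_neg (Ne.symm hk), if_pos rfl] at h1
    exact zero_ne_one h1
  refine SemidirectProduct.ext (funext fun i => Subtype.ext ?_) (Equiv.ext hr)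
  simpa [hr] using h i i

/-- A symplectic matrix with a single nonzero block, of determinant `1`, in each row of blocks is
block-monomial. -/
lemma mem_range_monomialHom {g : symplecticGroup ι K}
    (h : ∀ i, ∃ k, (planeBlock g.1 i k).det = 1 ∧ ∀ l, l ≠ k → planeBlock g.1 i l = 0) :
    g ∈ (monomialHom ι K).range := by
  choose p hp1 hp0 using h
  have hinj : Function.Injective p := by
    intro i j hij
    by_contra hne
    have h1 := sum_planeBlock_mul_adjugate g i j
    rw [if_neg hne, Finset.sum_eq_single (p i) (fun l _ hl => by rw [hp0 i l hl, Matrix.zero_mul])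
      (by simp)] at h1
    have h2 := congrArg det h1
    rw [det_mul, det_adjugate, hp1, hij, hp1] at h2
    simp at h2
  let σ := Equiv.ofBijective p (Finite.injective_iff_bijective.1 hinj)
  refine ⟨⟨fun i => ⟨planeBlock g.1 i (p i), hp1 i⟩, σ⁻¹⟩, ?_⟩
  refine Subtype.ext (ext_planeBlock fun i k => ?_)
  rw [planeBlock_monomialHom]
  have hσ : i = σ⁻¹ k ↔ k = p i := by
    rw [eq_comm, Equiv.Perm.inv_eq_iff_eq]
    rfl
  simp only [hσ]
  split_ifs with hk
  · rw [hk]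
  · rw [hp0 i k hk]

/-- Let `r` be the row of blocks of a symplectic matrix `g` at one hyperbolic plane. By
`planeBlock_conj_mulSingle`, the element `x` of `SL(2, K)` acting on that plane is conjugated by `g`
to the matrix with `(k, l)` block equal to `(if k = l then 1 else 0) + adj (r k) * (x - 1) * r l`.
If for `x = -1` and `x = quarterTurn K` this matrix has no nonzero block off the diagonal in a row
with nonzero diagonal block, then `r` has only one nonzero block: otherwise the diagonal block at an
invertible `r k` vanishes for both `x`, so that `2 * det (r k) = 1` and `2 * det (r k) ^ 2 = 1`. -/
lemma exists_det_eq_one_of_monomial {κ : Type*} [Fintype κ] (h2 : (2 : K) ≠ 0)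
    (r : κ → Matrix (Fin 2) (Fin 2) K)
    (hr : ∑ k, r k * (r k).adjugate = 1)
    (hmon : ∀ x ∈ ({-1, quarterTurn K} : Set SL(2, K)), ∀ k l, k ≠ l →
      (r k).adjugate * (x.1 - 1) * r l ≠ 0 → 1 + (r k).adjugate * (x.1 - 1) * r k = 0) :
    ∃ k, (r k).det = 1 ∧ ∀ l, l ≠ k → r l = 0 := by
  have hsum : ∑ k, (r k).det = 1 := by
    have := congrFun₂ hr 0 0
    simpa [mul_adjugate, Matrix.sum_apply] using this
  obtain ⟨k, -, hk⟩ : ∃ k ∈ Finset.univ, (r k).det ≠ 0 := by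
    apply Finset.exists_ne_zero_of_sum_ne_zero
    rw [hsum]
    exact one_ne_zero
  have hzero : ∀ l, l ≠ k → r l = 0 := by
    intro l hl
    by_contra hrl
    have hne : ∀ x : SL(2, K), (x.1 - 1).det ≠ 0 → (r k).adjugate * (x.1 - 1) * r l ≠ 0 := by
      intro x hx h
      apply hrl
      have hu : IsUnit ((r k).adjugate * (x.1 - 1)) := by
        rw [isUnit_iff_isUnit_det, det_mul, det_adjugate]
        simpa using ⟨hk, hx⟩
      exact (hu.mul_right_eq_zero).1 h
    have h1 := hmon (-1) (by simp) k l (Ne.symm hl) (hne _ (by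
      rw [det_fin_two]
      simp
      norm_num
      exact h2))
    have h3 := hmon (quarterTurn K) (by simp) k l (Ne.symm hl) (hne _ (by
      rw [det_fin_two]
      simp [quarterTurn]
      norm_num
      exact h2))
    have hd1 : 2 * (r k).det = 1 := by
      have h4 : (r k).adjugate * ((-1 : SL(2, K)).1 - 1) * r k =
          (-2 : K) • ((r k).det • (1 : Matrix (Fin 2) (Fin 2) K)) := by
        rw [← adjugate_mul]
        have : (-1 : SL(2, K)).1 - 1 = (-2 : K) • (1 : Matrix (Fin 2) (Fin 2) K) := by
          ext a b
          fin_cases a <;> fin_cases b <;> simp <;> norm_num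
        rw [this]
        simp
      rw [h4] at h1
      have := congrFun₂ h1 0 0
      simp at this
      linear_combination -this
    have hd2 : 2 * (r k).det ^ 2 = 1 := by
      have h4 : (r k).adjugate * ((quarterTurn K).1 - 1) * r k = -1 := by
        rw [← add_eq_zero_iff_eq_neg, add_comm, h3]
      have h5 := congrArg det h4
      have h6 : ((quarterTurn K).1 - 1).det = 2 := by
        rw [det_fin_two]
        simp [quarterTurn]
        norm_num
      rw [det_mul, det_mul, det_adjugate, h6, det_neg] at h5
      simp at h5
      linear_combination h5
    have : (1 : K) = 0 := by
      linear_combination (2 * (r k).det + 1) * hd1 - 2 * hd2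
    exact one_ne_zero this
  refine ⟨k, ?_, hzero⟩
  rw [← hsum, Finset.sum_eq_single k]
  · intro l _ hl
    simp [hzero l hl]
  · simp

lemma planeBlock_conj_mulSingle (g : symplecticGroup ι K) (i : ι) (x : SL(2, K)) (k l : ι) :
    planeBlock (g⁻¹ * monomialHom ι K (SemidirectProduct.inl (Pi.mulSingle i x)) * g).1 k l =
      (if k = l then 1 else 0) +
        (planeBlock g.1 i k).adjugate * (x.1 - 1) * planeBlock g.1 i l := by
  rw [mul_assoc, Submonoid.coe_mul, planeBlock_mul, ← sum_adjugate_mul_planeBlock g k l,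
    ← sub_eq_iff_eq_add', ← Finset.sum_sub_distrib]
  have h : ∀ j, planeBlock (monomialHom ι K (SemidirectProduct.inl (Pi.mulSingle i x)) * g).1 j l =
      ((Pi.mulSingle i x : ι → SL(2, K)) j).1 * planeBlock g.1 j l := by
    intro j
    rw [Submonoid.coe_mul, planeBlock_mul, Finset.sum_eq_single j]
    · simp [planeBlock_monomialHom]
    · intro m _ hm
      simp [planeBlock_monomialHom, Ne.symm hm]
    · simp
  simp only [h, planeBlock_inv]
  rw [Finset.sum_eq_single i]
  · simp [Matrix.mul_assoc, sub_mul, mul_sub]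
  · intro j _ hj
    simp [Pi.mulSingle_eq_of_ne hj]
  · simp

/-- The quarter turns in the single standard planes generate an abelian `2`-group, and the only
decomposition into hyperbolic planes that it preserves is the standard one. -/
lemma odd_index_range_monomialHom [Finite K] (h2 : (2 : K) ≠ 0) :
    Odd (monomialHom ι K).range.index := by
  let C : Subgroup (symplecticGroup ι K) :=
    (Subgroup.pi Set.univ fun _ : ι => Subgroup.zpowers (quarterTurn K)).map
      ((monomialHom ι K).comp SemidirectProduct.inl)
  have hC4 : ∀ c ∈ C, c ^ 4 = 1 := by
    rintro _ ⟨a, ha, rfl⟩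
    rw [← map_pow]
    suffices a ^ 4 = 1 by rw [this, map_one]
    ext1 i
    obtain ⟨k, hk⟩ := ha i (Set.mem_univ i)
    change a i ^ 4 = 1
    have h4 : quarterTurn K ^ 4 = 1 := by
      rw [show 4 = 2 * 2 from rfl, pow_mul, quarterTurn_sq, neg_one_sq]
    change quarterTurn K ^ k = a i at hk
    rw [← hk, ← zpow_natCast, ← _root_.zpow_mul, mul_comm, _root_.zpow_mul, zpow_natCast]
    simp [h4]
  have hCmem : ∀ i, ∀ x ∈ Subgroup.zpowers (quarterTurn K),
      monomialHom ι K (SemidirectProduct.inl (Pi.mulSingle i x)) ∈ C := by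
    intro i x hx
    refine ⟨Pi.mulSingle i x, fun j _ => ?_, rfl⟩
    by_cases hj : j = i
    · subst hj
      simpa using hx
    · rw [Pi.mulSingle_eq_of_ne hj]
      exact Subgroup.one_mem _
  refine odd_index_of_forall_conj_mem (C := C) ?_ ?_ ?_
  · exact fun c => ⟨2, Subtype.ext (hC4 c c.2)⟩
  · rintro _ ⟨a, -, rfl⟩
    exact ⟨_, rfl⟩
  · intro g hg
    refine mem_range_monomialHom fun i => exists_det_eq_one_of_monomial h2 _ ?_ ?_
    · simpa using sum_planeBlock_mul_adjugate g i i
    · intro x hx k l hkl hne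
      have hxz : x ∈ Subgroup.zpowers (quarterTurn K) := by
        rcases hx with rfl | rfl
        · rw [← quarterTurn_sq]
          exact Subgroup.npow_mem_zpowers _ 2
        · exact Subgroup.mem_zpowers _
      obtain ⟨y, hy⟩ := hg _ (hCmem i x hxz)
      have hB := planeBlock_conj_mulSingle g i x
      rw [← hy] at hB
      simp only [planeBlock_monomialHom] at hB
      have hl := hB k l
      have hk := hB k k
      rw [if_neg hkl, zero_add] at hl
      rw [← hl] at hne
      have hkl' : k = y.right l := by
        by_contra h
        rw [if_neg h] at hne
        exact hne rfl
      rw [if_pos rfl, if_neg] at hk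
      · exact hk.symm
      · rw [hkl']
        intro h
        have := y.right.injective h
        exact hkl (hkl'.trans this.symm)

end Blocks

/-! ### The non-pronormal subgroup of odd index -/

lemma PermWreath.left_mem_center_of_forall_commute {S ι : Type*} [Group S]
    {x : PermWreath S ι (Equiv.Perm ι)}
    (hx : ∀ y, y * x = x * y) (i : ι) : x.left i ∈ Subgroup.center S := by
  rw [Subgroup.mem_center_iff]
  intro s
  have h := congrArg (fun z : PermWreath S ι (Equiv.Perm ι) => z.left i)
    (hx (SemidirectProduct.inl fun _ => s))
  simpa [PermWreath.mul_left_apply] using h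

theorem mainTheorem3 (n q : ℕ) (hn : 1 ≤ n)
    (K : Type*) [Field K] [Finite K] (hK : Nat.card K = q)
    (hq : (q : ℤ) ≡ 3 [ZMOD 8] ∨ (q : ℤ) ≡ -3 [ZMOD 8])
    (hn₁ : ¬ ∃ w : ℕ, n = 2 ^ w)
    (hn₂ : ¬ ∃ w k : ℕ, n = 2 ^ w * (2 ^ (2 * k) + 1)) :
    ∃ H : Subgroup (ProjectiveSymplecticGroup n K), Odd H.index ∧ ¬ IsPronormal H := by
  have hq8 : Nat.card K % 8 = 3 ∨ Nat.card K % 8 = 5 := by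
    rw [hK]
    simp only [Int.ModEq] at hq
    omega
  obtain ⟨m, hm0, hmn, hm3, hodd⟩ := exists_odd_choose_three_dvd n hn hn₁ hn₂
  obtain ⟨N, A, _, _, f, φ, hf, hindex, hcenter, hA, hφ⟩ := exists_hom_odd_index_map_ker K hq8
  have h2 : (2 : K) ≠ 0 := two_ne_zero_of_odd_card (Nat.odd_iff.2 (by omega))
  obtain ⟨s, hs⟩ : ∃ s : Finset (Fin n), s.card = m :=
    (Finset.exists_subset_card_eq (s := Finset.univ) (by simpa)).imp fun _ h => h.2
  -- The same set, as a point of the transitive action on all sets of size `m`.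
  let s' : Set.powersetCard (Fin n) m := ⟨s, hs⟩
  let T := MulAction.stabilizer (Equiv.Perm (Fin n)) s'
  have hTindex : T.index = n.choose m := by
    have := Set.powersetCard.isPretransitive (α := Fin n) (n := m)
    rw [MulAction.index_stabilizer_of_transitive, Set.powersetCard.card, Nat.card_fin]
  have hTs : ∀ t : T, ∀ i ∈ s, t • i ∈ s := by
    intro t i hi
    have h : t.1 • s = s := congrArg Subtype.val t.2
    rw [← h]
    exact Finset.smul_mem_smul_finset hi
  have hTtr : ∀ i ∈ s, ∀ j ∈ s, ∃ t : T, t • i = j := by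
    intro i hi j hj
    refine ⟨⟨Equiv.swap i j, ?_⟩, Equiv.swap_apply_left i j⟩
    refine Subtype.ext (Finset.eq_of_subset_of_card_le ?_ (Finset.card_smul_finset _ s).ge)
    intro y hy
    obtain ⟨x, hx, rfl⟩ := Finset.mem_smul_finset.1 hy
    rw [Equiv.Perm.smul_def, Equiv.swap_apply_def]
    split_ifs <;> assumption
  let H := PermWreath.kerWreath φ (Fin n) T
  have hH : ¬ IsPronormal H := by
    refine PermWreath.not_isPronormal_kerWreath φ s (Finset.card_pos.1 (hs ▸ hm0)) hTs hTtr ?_ hφ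
    intro a
    obtain ⟨c, hc⟩ := hm3
    rw [hs, hc, pow_mul, hA, one_pow]
  let e : PermWreath N (Fin n) T →* PermWreath SL(2, K) (Fin n) (Equiv.Perm (Fin n)) :=
    PermWreath.map f T.subtype fun _ _ => rfl
  have he : Function.Injective e := PermWreath.map_injective _ _ _ hf T.subtype_injective
  -- The image of `H` has odd index in the wreath product by comparison of orders.
  have h1 : Odd (H.map e).index := by
    have hc := (H.map e).card_mul_index
    rw [Subgroup.card_map_of_injective he, PermWreath.card_kerWreath, SemidirectProduct.card,
      Nat.card_fun, ← (φ.ker.map f).card_mul_index, ← T.card_mul_index,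
      Subgroup.card_map_of_injective hf, mul_pow, hTindex] at hc
    have hpos : 0 < Nat.card φ.ker ^ Nat.card (Fin n) * Nat.card T := by
      have : Finite N := Finite.of_injective f hf
      have := Nat.card_pos (α := φ.ker)
      have := Nat.card_pos (α := T)
      positivity
    have hval : (H.map e).index = (φ.ker.map f).index ^ Nat.card (Fin n) * n.choose m := by
      apply Nat.eq_of_mul_eq_mul_left hpos
      rw [hc]
      ring
    rw [hval]
    exact hindex.pow.mul hodd
  let π := QuotientGroup.mk' (Subgroup.center (symplecticGroup (Fin n) K))
  let F := π.comp ((monomialHom (Fin n) K).comp e)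
  have hker : F.ker ≤ H := by
    intro x hx i
    have hx' : monomialHom (Fin n) K (e x) ∈ Subgroup.center (symplecticGroup (Fin n) K) :=
      (QuotientGroup.eq_one_iff _).1 hx
    have hcomm : ∀ y, y * e x = e x * y := fun y => monomialHom_injective (by
      rw [map_mul, map_mul]
      exact Subgroup.mem_center_iff.1 hx' _)
    obtain ⟨z, hz, hzx⟩ := hcenter (PermWreath.left_mem_center_of_forall_commute hcomm i)
    exact hf hzx ▸ hz
  refine ⟨H.map F, ?_, fun h => hH (IsPronormal.of_map F H hker h)⟩
  have h3 : H.map F = ((H.map e).map (monomialHom (Fin n) K)).map π := by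
    rw [Subgroup.map_map, Subgroup.map_map]
    rfl
  rw [h3]
  refine Odd.of_dvd_nat ?_ (Subgroup.index_map_dvd _ (QuotientGroup.mk'_surjective _))
  rw [Subgroup.index_map_of_injective _ monomialHom_injective]
  exact h1.mul (odd_index_range_monomialHom h2)
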